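/- All varieties are varieties of monoids. For a semigroup $S$, let $S^1$ be the monoid obtained from $S$ by adjoining a new identity element. Let $\mathbb A^1$ and $\mathbb E^1$ be the monoid varieties generated by the monoids $A^1$ and $E^1$ respectively, where $A$ and $E$ are the semigroups with zero \[ A=\langle a,b,c\mid a^2=a,\ b^2=b,\ ab=ca=0,\ ac=cb=c\rangle=\{a,b,c,ba,bc,0\}, \] \[ E=\langle a,b,c\mid a^2=ab=0,\ ba=ca=a,\ b^2=bc=b,\ c^2=cb=c\rangle=\{a,b,c,ac,0\}. \] Let $\mathbb E^1\{\sigma_2\}$ be the variety of all monoids satisfying the identities \[ xtx\approx xtx^2\approx x^2tx,\qquad xy^2x\approx x^2y^2,\qquad b\,t_2\,a\,t_1\,a^2b^2\approx b\,t_2\,a\,t_1\,b^2a^2 . \] Then every monoid variety $\mathbb V$ with \[ \mathbb A^1\vee\mathbb E^1\{\sigma_2\}\ \subseteq\ \mathbb V\ \subseteq\ \mathbb A^1\vee\mathbb E^1, \] where $\vee$ denotes the join in the lattice of monoid varieties, is non-finitely based: there is no finite set of identities such that $\mathbb V$ is the class of all monoids satisfying them. -/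

import Mathlib

universe u

namespace MonVar

/-! ### Words, identities, satisfaction -/

/-- Words over a countably infinite alphabet: elements of the free monoid on `ℕ`. -/
abbrev Word : Type := FreeMonoid ℕ

/-- The letter with index `i`, as a word. -/
def letter (i : ℕ) : Word := FreeMonoid.of i

/-- A monoid identity `u ≈ v`, represented by the pair `(u, v)`. -/
abbrev Identity : Type := Word × Word

/-- The monoid `M` satisfies the identity `u ≈ v`: both sides take the same value under every
substitution of elements of `M` for letters. -/
def Satisfies (M : Type u) [Monoid M] (e : Identity) : Prop :=
  ∀ φ : Word →* M, φ e.1 = φ e.2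

/-! ### Varieties of monoids -/

/-- A variety of monoids: a class of monoids closed under homomorphic images, submonoids (up to
isomorphism) and arbitrary direct products. -/
@[ext]
structure MonoidVariety where
  /-- `V.Mem M` says that the monoid `M` belongs to the variety `V`. -/
  Mem : ∀ (M : Type u) [Monoid M], Prop
  image_mem : ∀ {M N : Type u} [Monoid M] [Monoid N] (f : M →* N),
    Function.Surjective f → Mem M → Mem N
  sub_mem : ∀ {M N : Type u} [Monoid M] [Monoid N] (f : M →* N),
    Function.Injective f → Mem N → Mem M
  pi_mem : ∀ {ι : Type u} (M : ι → Type u) [∀ i, Monoid (M i)],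
    (∀ i, Mem (M i)) → Mem (∀ i, M i)

namespace MonoidVariety

/-- Varieties are ordered by inclusion. -/
instance : PartialOrder MonoidVariety.{u} where
  le V W := ∀ (M : Type u) [Monoid M], V.Mem M → W.Mem M
  le_refl _ _ _ h := h
  le_trans _ _ _ h₁ h₂ M _ h := h₂ M (h₁ M h)
  le_antisymm V W h₁ h₂ := by
    ext M inst
    exact ⟨h₁ M, h₂ M⟩

/-- The variety generated by a class `K` of monoids: the least variety containing `K`, that is, the
intersection of all varieties containing `K`. -/
def generatedBy (K : ∀ (M : Type u) [Monoid M], Prop) : MonoidVariety.{u} where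
  Mem M _ := ∀ W : MonoidVariety.{u}, (∀ (N : Type u) [Monoid N], K N → W.Mem N) → W.Mem M
  image_mem f hf h W hW := W.image_mem f hf (h W hW)
  sub_mem f hf h W hW := W.sub_mem f hf (h W hW)
  pi_mem M _ h W hW := W.pi_mem M fun i => h i W hW

/-- The join `V ⊔ W` is the least variety containing both `V` and `W`. -/
instance : SemilatticeSup MonoidVariety.{u} where
  sup V W := generatedBy fun M _ => V.Mem M ∨ W.Mem M
  le_sup_left _ _ M _ h _ hX := hX M (Or.inl h)
  le_sup_right _ _ M _ h _ hX := hX M (Or.inr h)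
  sup_le _ _ X h₁ h₂ _ _ h := h X fun N _ hN => hN.elim (h₁ N) (h₂ N)

/-- The variety generated by a single monoid `S` (which may live in the lowest universe). -/
def generatedByMonoid (S : Type) [Monoid S] : MonoidVariety.{u} :=
  generatedBy fun M _ => Nonempty (M ≃* S)

/-- `var Σ`: the variety of all monoids satisfying every identity in `Σ`. -/
def ofIdentities (E : Set Identity) : MonoidVariety.{u} where
  Mem M _ := ∀ e ∈ E, Satisfies M e
  image_mem {M N} _ _ f hf h e he φ := by
    choose g hg using fun i : ℕ => hf (φ (FreeMonoid.of i))
    have hφ : f.comp (FreeMonoid.lift g) = φ := by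
      ext i
      simp [hg]
    rw [← hφ]
    exact congrArg f (h e he (FreeMonoid.lift g))
  sub_mem f hf h e he φ := hf (h e he (f.comp φ))
  pi_mem M _ h e he φ := by
    funext i
    exact h i e he ((Pi.evalMonoidHom M i).comp φ)

/-- A variety is finitely based if it is defined by some finite set of identities. -/
def IsFinitelyBased (V : MonoidVariety.{u}) : Prop :=
  ∃ E : Set Identity, E.Finite ∧ V = ofIdentities E

end MonoidVariety

/-! ### The semigroup `A` -/

/-- The elements of the semigroup
`A = ⟨a, b, c ∣ a² = a, b² = b, ab = ca = 0, ac = cb = c⟩ = {a, b, c, ba, bc, 0}`. -/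
inductive SemigroupA : Type
  | a | b | c | ba | bc | zero
  deriving DecidableEq

namespace SemigroupA

/-- The multiplication table of `A`; all products not listed are `0`. -/
def mul : SemigroupA → SemigroupA → SemigroupA
  | a, a => a
  | a, c => c
  | b, a => ba
  | b, b => b
  | b, c => bc
  | b, ba => ba
  | b, bc => bc
  | c, b => c
  | ba, a => ba
  | ba, c => bc
  | bc, b => bc
  | _, _ => zero

instance : Semigroup SemigroupA where
  mul := mul
  mul_assoc := by rintro ⟨⟩ ⟨⟩ ⟨⟩ <;> rfl

end SemigroupA

/-! ### The semigroup `E` -/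

/-- The elements of the semigroup
`E = ⟨a, b, c ∣ a² = ab = 0, ba = ca = a, b² = bc = b, c² = cb = c⟩ = {a, b, c, ac, 0}`. -/
inductive SemigroupE : Type
  | a | b | c | ac | zero
  deriving DecidableEq

namespace SemigroupE

/-- The multiplication table of `E`; all products not listed are `0`. -/
def mul : SemigroupE → SemigroupE → SemigroupE
  | a, c => ac
  | b, a => a
  | b, b => b
  | b, c => b
  | b, ac => ac
  | c, a => a
  | c, b => c
  | c, c => c
  | c, ac => ac
  | ac, b => ac
  | ac, c => ac
  | _, _ => zero

instance : Semigroup SemigroupE where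
  mul := mul
  mul_assoc := by rintro ⟨⟩ ⟨⟩ ⟨⟩ <;> rfl

end SemigroupE

/-! ### The varieties in question

For a semigroup `S`, the monoid `S¹` obtained by adjoining a new identity element is `WithOne S`. -/

/-- `𝔸¹`, the variety generated by the monoid `A¹`. -/
def varA1 : MonoidVariety.{u} := MonoidVariety.generatedByMonoid (WithOne SemigroupA)

/-- `𝔼¹`, the variety generated by the monoid `E¹`. -/
def varE1 : MonoidVariety.{u} := MonoidVariety.generatedByMonoid (WithOne SemigroupE)

/-- The letter `t_k` (for `k ≥ 1`); the letters `a` and `b` below have indices `0` and `1`. -/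
def tLetter (k : ℕ) : Word := letter (k + 1)

/-- `u₀ = a²b²`, and `u_{k+1} = a t_{k+1} u_k` for even `k`, `u_{k+1} = b t_{k+1} u_k` for odd
`k`. -/
def uWord : ℕ → Word
  | 0 => letter 0 ^ 2 * letter 1 ^ 2
  | k + 1 => (if Even k then letter 0 else letter 1) * tLetter (k + 1) * uWord k

/-- `v₀ = b²a²`, and `v_{k+1} = a t_{k+1} v_k` for even `k`, `v_{k+1} = b t_{k+1} v_k` for odd
`k`. -/
def vWord : ℕ → Word
  | 0 => letter 1 ^ 2 * letter 0 ^ 2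
  | k + 1 => (if Even k then letter 0 else letter 1) * tLetter (k + 1) * vWord k

/-- The defining identities of `𝔼¹{σ_n}`:
`xtx ≈ xtx² ≈ x²tx`, `xy²x ≈ x²y²` and `u_n ≈ v_n`. -/
def identitiesESigma (n : ℕ) : Set Identity :=
  let x := letter 0
  let y := letter 1
  let t := letter 2
  {(x * t * x, x * t * x ^ 2), (x * t * x ^ 2, x ^ 2 * t * x),
    (x * y ^ 2 * x, x ^ 2 * y ^ 2), (uWord n, vWord n)}

/-- The variety `𝔼¹{σ_n}`. -/
def varE1Sigma (n : ℕ) : MonoidVariety.{u} := MonoidVariety.ofIdentities (identitiesESigma n)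

end MonVar

/-! Suppose a finite set `E` of identities defines the variety, and let `n` exceed the number of
letters on each side of every identity in `E`. The identity `unsplitWord n` ≈ `splitWord n`, that is
0 1² 2² ⋯ n² 0 ≈ 0 1² 0 2² ⋯ n² 0, holds in A¹ and E¹ (`holds_A`, `holds_E`), hence in every variety
below the upper bound. It remains to find a model of `E` in which it fails: the syntactic monoid of
the set of words with `Unsplit n`, which contains the left side but not the right.

That this monoid satisfies `E` means that applying an identity of `E` inside a word preserves
`Unsplit n` (`Unsplit.of_holds`). The lower bound enters only through A¹ and one finite monoid
`Trans` of 𝔼¹{σ₂}. A¹ fixes the two-letter scattered subwords, and those lying before a linear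
letter; `Trans` fixes which of two letters occurs first, also after a linear letter. If a 0 did
split the sequence 1, …, n, the whole sequence would come from letters between two occurrences of
one letter `z`. With fewer than `n` letters available, some letter between them has two of the
numbers in its value, so it occurs only once, and comparison of orders relative to this linear
letter gives a contradiction (`Unsplit.mem_of_split`). -/

namespace MonVar

/-! ### Evaluation of words -/

/-- The identity `s ≈ t` holds in `M`. -/
def Holds (M : Type u) [Monoid M] (s t : List ℕ) : Prop :=
  ∀ f : ℕ → M, (s.map f).prod = (t.map f).prod

theorem Holds.symm {M : Type u} [Monoid M] {s t : List ℕ} (h : Holds M s t) : Holds M t s :=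
  fun f => (h f).symm

theorem prod_flatMap {M : Type u} [Monoid M] (g : ℕ → M) (f : ℕ → List ℕ) (s : List ℕ) :
    ((s.flatMap f).map g).prod = (s.map fun i => ((f i).map g).prod).prod := by
  induction s with
  | nil => rfl
  | cons i s ih => simp [ih]

theorem Holds.context {M : Type u} [Monoid M] {s t : List ℕ} (h : Holds M s t)
    (f : ℕ → List ℕ) (l r : List ℕ) :
    Holds M (l ++ (s.flatMap f ++ r)) (l ++ (t.flatMap f ++ r)) := by
  intro g
  simp only [List.map_append, List.prod_append, prod_flatMap]
  rw [h]

theorem satisfies_iff_holds {M : Type u} [Monoid M] {s t : List ℕ} :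
    Satisfies M (FreeMonoid.ofList s, FreeMonoid.ofList t) ↔ Holds M s t := by
  constructor
  · intro h f
    simpa [FreeMonoid.lift_apply] using h (FreeMonoid.lift f)
  · intro h φ
    obtain ⟨f, rfl⟩ := FreeMonoid.lift.surjective φ
    simpa [FreeMonoid.lift_apply] using h f

theorem satisfies_uLift {M : Type} [Monoid M] {e : Identity} :
    Satisfies (ULift.{u} M) e ↔ Satisfies M e := by
  constructor
  · intro h φ
    have := h (MulEquiv.ulift.symm.toMonoidHom.comp φ)
    exact congrArg ULift.down this
  · intro h φ
    let g : ULift.{u} M →* M := MulEquiv.ulift.toMonoidHom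
    exact ULift.ext _ _ (h (g.comp φ))

/-! ### Identities of `A¹` -/

section SemigroupA

instance : Fintype SemigroupA :=
  ⟨{.a, .b, .c, .ba, .bc, .zero}, by rintro ⟨⟩ <;> decide⟩

instance : Fintype SemigroupE :=
  ⟨{.a, .b, .c, .ac, .zero}, by rintro ⟨⟩ <;> decide⟩

instance {S : Type} [DecidableEq S] : DecidableEq (WithOne S) :=
  inferInstanceAs (DecidableEq (Option S))

instance {S : Type} [Fintype S] : Fintype (WithOne S) :=
  inferInstanceAs (Fintype (Option S))

/-- The substitution `y ↦ a`, `z ↦ b`, `p ↦ c`, all other letters to the identity. -/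
def substA (y z p : ℕ) (i : ℕ) : WithOne SemigroupA :=
  if i = y then (SemigroupA.a : SemigroupA) else if i = z then (SemigroupA.b : SemigroupA)
  else if i = p then (SemigroupA.c : SemigroupA) else 1

-- Since ab = 0 while ba ≠ 0, the value records which of `y`, `z` occur and whether some `y`
-- precedes some `z`.
open Classical in
theorem prod_substA {y z p : ℕ} (hyz : y ≠ z) (s : List ℕ) (hp : p ∉ s) :
    (s.map (substA y z p)).prod =
      if [y, z].Sublist s then ((SemigroupA.zero : SemigroupA) : WithOne SemigroupA)
      else if z ∈ s then (if y ∈ s then (SemigroupA.ba : SemigroupA) else (SemigroupA.b : SemigroupA))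
      else if y ∈ s then (SemigroupA.a : SemigroupA) else 1 := by
  induction s with
  | nil => simp
  | cons i s ih =>
    have hp' : p ∉ s := fun h => hp (List.mem_cons_of_mem _ h)
    have hpi : i ≠ p := fun h => hp (by simp [h])
    have hsub : [y, z].Sublist s → y ∈ s ∧ z ∈ s := fun h =>
      ⟨h.subset (by simp), h.subset (by simp)⟩
    rw [List.map_cons, List.prod_cons, ih hp']
    by_cases hy : i = y
    · subst hy
      have h1 : [i, z].Sublist (i :: s) ↔ z ∈ s := by simp
      have h2 : substA i z p i = ((SemigroupA.a : SemigroupA) : WithOne SemigroupA) := by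
        simp [substA]
      rw [h2]
      simp only [h1, List.mem_cons, hyz.symm, false_or, true_or, if_true]
      split_ifs <;> first | rfl | tauto
    · have h1 : [y, z].Sublist (i :: s) ↔ [y, z].Sublist s := by
        constructor
        · intro h
          cases h with
          | cons _ h => exact h
          | cons_cons _ h => exact absurd rfl hy
        · exact fun h => h.cons _
      by_cases hz : i = z
      · subst hz
        have h2 : substA y i p i = ((SemigroupA.b : SemigroupA) : WithOne SemigroupA) := by
          simp [substA, hyz.symm]
        rw [h2]
        simp only [h1, List.mem_cons, hyz, false_or, true_or, if_true]
        split_ifs <;> rfl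
      · have h2 : substA y z p i = 1 := by simp [substA, hy, hz, hpi]
        simp only [h2, one_mul, h1, List.mem_cons, Ne.symm hy, Ne.symm hz, false_or]

-- Since c² = 0, the value distinguishes zero, one and at least two occurrences of `p`.
open Classical in
theorem prod_substA_single (p : ℕ) (s : List ℕ) :
    (s.map (fun i => if i = p then ((SemigroupA.c : SemigroupA) : WithOne SemigroupA) else 1)).prod =
      if [p, p].Sublist s then ((SemigroupA.zero : SemigroupA) : WithOne SemigroupA)
      else if p ∈ s then (SemigroupA.c : SemigroupA) else 1 := by
  induction s with
  | nil => simp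
  | cons i s ih =>
    rw [List.map_cons, List.prod_cons, ih]
    have hsub : [p, p].Sublist s → p ∈ s := fun h => h.subset (by simp)
    by_cases hp : i = p
    · subst hp
      have h1 : [i, i].Sublist (i :: s) ↔ i ∈ s := by simp
      simp only [h1, List.mem_cons, true_or, if_true]
      split_ifs <;> first | rfl | tauto
    · have h1 : [p, p].Sublist (i :: s) ↔ [p, p].Sublist s := by
        constructor
        · intro h
          cases h with
          | cons _ h => exact h
          | cons_cons _ h => exact absurd rfl hp
        · exact fun h => h.cons _
      simp only [hp, if_false, one_mul, h1, List.mem_cons, Ne.symm hp, false_or]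

variable {s t : List ℕ}

theorem mem_iff_of_satisfies_A
    (h : Holds (WithOne SemigroupA) s t) (p : ℕ) :
    p ∈ s ↔ p ∈ t := by
  classical
  have := h (fun i => if i = p then ((SemigroupA.c : SemigroupA) : WithOne SemigroupA) else 1)
  rw [prod_substA_single, prod_substA_single] at this
  have h1 : [p, p].Sublist s → p ∈ s := fun h => h.subset (by simp)
  have h2 : [p, p].Sublist t → p ∈ t := fun h => h.subset (by simp)
  split_ifs at this <;> tauto

theorem pair_sublist_iff_of_satisfies_A
    (h : Holds (WithOne SemigroupA) s t) (y z : ℕ) :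
    [y, z].Sublist s ↔ [y, z].Sublist t := by
  classical
  by_cases hyz : y = z
  · subst hyz
    have := h (fun i => if i = y then ((SemigroupA.c : SemigroupA) : WithOne SemigroupA) else 1)
    rw [prod_substA_single, prod_substA_single] at this
    split_ifs at this <;> tauto
  -- The value c is not needed here, so it is assigned to a letter absent from both words.
  · obtain ⟨p, hp⟩ := Infinite.exists_notMem_finset (s ++ t).toFinset
    have hp : p ∉ s ∧ p ∉ t := by simpa using hp
    have := h (substA y z p)
    rw [prod_substA hyz _ hp.1, prod_substA hyz _ hp.2] at this
    split_ifs at this <;> tauto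

/-- Under `y ↦ a`, `z ↦ b`, `p ↦ c` the right side is 0 because `t₁` already is. If no `y` preceded
a `z` in `s₁`, the left side would be c or bc: the value of `s₁` lies in {1, a, b, ba}, and what
follows `p` lies in {1, b}, which fixes c on the right. -/
theorem pair_sublist_before_linear
    {s₁ s₂ t₁ t₂ : List ℕ} {p y z : ℕ}
    (h : Holds (WithOne SemigroupA) (s₁ ++ p :: s₂) (t₁ ++ p :: t₂))
    (hs₁ : p ∉ s₁) (hs₂ : p ∉ s₂) (ht₁ : p ∉ t₁) (ht₂ : p ∉ t₂)
    (hyz : y ≠ z) (hy : y ≠ p) (hz : z ≠ p) (hys : y ∉ s₂)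
    (ht : [y, z].Sublist t₁) : [y, z].Sublist s₁ := by
  classical
  by_contra hs
  have h2 : ¬ [y, z].Sublist s₂ := fun h => hys (h.subset (by simp))
  have hc : substA y z p p = ((SemigroupA.c : SemigroupA) : WithOne SemigroupA) := by
    simp [substA, hy.symm, hz.symm]
  have := h (substA y z p)
  simp only [List.map_append, List.map_cons, List.prod_append, List.prod_cons,
    prod_substA hyz _ hs₁, prod_substA hyz _ hs₂, prod_substA hyz _ ht₁,
    prod_substA hyz _ ht₂, if_pos ht, if_neg hs, if_neg h2, if_neg hys, hc] at this
  split_ifs at this <;> revert this <;> decide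

end SemigroupA

/-! ### A monoid in `𝔼¹{σ₂}` -/

/-- The transition monoid of the automaton with states `0, 1, 2` and partial transitions
`z : 0 ↦ 0, 2 ↦ 2`, `y : 1 ↦ 2, 2 ↦ 2`, `p : 0 ↦ 1`. -/
inductive Trans : Type
  | one | z | y | p | py | e | zero
  deriving DecidableEq

namespace Trans

instance : Fintype Trans :=
  ⟨{.one, .z, .y, .p, .py, .e, .zero}, by rintro ⟨⟩ <;> decide⟩

/-- The multiplication table of `Trans`; all products not listed are `0`. -/
def mul : Trans → Trans → Trans
  | one, u => u
  | u, one => u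
  | z, z => z
  | z, y => e
  | z, p => p
  | z, py => py
  | z, e => e
  | y, z => y
  | y, y => y
  | y, e => y
  | p, y => py
  | py, z => py
  | py, y => py
  | py, e => py
  | e, z => e
  | e, y => e
  | e, e => e
  | _, _ => zero

instance : Monoid Trans where
  mul := mul
  one := one
  mul_assoc := by rintro ⟨⟩ ⟨⟩ ⟨⟩ <;> rfl
  one_mul := by rintro ⟨⟩ <;> rfl
  mul_one := by rintro ⟨⟩ <;> rfl

theorem mem_varE1Sigma : (varE1Sigma.{u} 2).Mem (ULift.{u} Trans) := by
  intro e he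
  rw [satisfies_uLift]
  have h1 : ∀ x t : Trans, x * t * x = x * t * x ^ 2 ∧ x * t * x ^ 2 = x ^ 2 * t * x := by decide
  have h2 : ∀ u v : Trans, u * v ^ 2 * u = u ^ 2 * v ^ 2 := by decide
  -- The squares fail to commute only when one value is `y` and the other is `z` or `e`. The prefix
  -- then contains `y`, after which only state 2 can survive, and both letters fix it. The nested
  -- disjunctions let `decide` range over `t₁`, `t₂` only where needed.
  have h3 : ∀ a b : Trans, a ^ 2 * b ^ 2 = b ^ 2 * a ^ 2 ∨
      ∀ t₁, a * t₁ * (a ^ 2 * b ^ 2) = a * t₁ * (b ^ 2 * a ^ 2) ∨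
      ∀ t₂, b * (t₂ * (a * (t₁ * (a ^ 2 * b ^ 2)))) = b * (t₂ * (a * (t₁ * (b ^ 2 * a ^ 2)))) := by
    decide
  rcases he with rfl | rfl | rfl | rfl
  · intro φ
    simpa using (h1 _ _).1
  · intro φ
    simpa using (h1 _ _).2
  · intro φ
    simpa using h2 _ _
  · intro φ
    have hu : uWord 2 = letter 1 * tLetter 2 * (letter 0 * tLetter 1 *
        (letter 0 ^ 2 * letter 1 ^ 2)) := by simp [uWord]
    have hv : vWord 2 = letter 1 * tLetter 2 * (letter 0 * tLetter 1 *
        (letter 1 ^ 2 * letter 0 ^ 2)) := by simp [vWord]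
    simp only [hu, hv, map_mul, map_pow]
    rcases h3 (φ (letter 0)) (φ (letter 1)) with h | h
    · rw [h]
    · rcases h (φ (tLetter 1)) with h | h
      · rw [h]
      · simpa only [mul_assoc] using h (φ (tLetter 2))

/-- The substitution of `y`, `z` and `p` for the letters with the given indices. -/
def subst (iy iz ip : ℕ) (i : ℕ) : Trans :=
  if i = iy then y else if i = iz then z else if i = ip then p else 1

end Trans

/-- `y` occurs in `s`, and no `z` occurs before its first occurrence. -/
def FirstBefore (y z : ℕ) (s : List ℕ) : Prop := ∃ l r, s = l ++ y :: r ∧ z ∉ l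

theorem firstBefore_cons {y z i : ℕ} {s : List ℕ} :
    FirstBefore y z (i :: s) ↔ i = y ∨ i ≠ z ∧ FirstBefore y z s := by
  constructor
  · rintro ⟨_ | ⟨j, l⟩, r, h, hz⟩
    · exact Or.inl (List.cons.inj h).1
    · obtain ⟨rfl, rfl⟩ := List.cons.inj h
      simp only [List.mem_cons, not_or] at hz
      exact Or.inr ⟨Ne.symm hz.1, l, r, rfl, hz.2⟩
  · rintro (rfl | ⟨h, l, r, rfl, hz⟩)
    · exact ⟨[], s, rfl, by simp⟩
    · exact ⟨i :: l, r, rfl, by simp [hz, h.symm]⟩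

theorem FirstBefore.mem_of_eq {y z : ℕ} {s l r : List ℕ} (h : FirstBefore y z s) (hyz : y ≠ z)
    (hs : s = l ++ z :: r) : y ∈ l := by
  induction l generalizing s with
  | nil =>
    subst hs
    rw [List.nil_append, firstBefore_cons] at h
    tauto
  | cons i l ih =>
    subst hs
    rw [List.cons_append, firstBefore_cons] at h
    rcases h with rfl | h
    · simp
    · exact List.mem_cons_of_mem _ (ih h.2 rfl)

theorem firstBefore_append {y z : ℕ} {l r : List ℕ} (hy : y ∈ l) (hz : z ∉ l) :
    FirstBefore y z (l ++ r) := by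
  obtain ⟨l₁, l₂, rfl⟩ := List.append_of_mem hy
  exact ⟨l₁, l₂ ++ r, by simp, fun h => hz (by simp [h])⟩

section Trans

-- State 1 survives exactly when `y` is read before any `z`: `y` moves it to 2, where both letters
-- act trivially, while `z` kills it. This separates the value `y` from the others.
open Classical in
theorem prod_substTrans {y z p : ℕ} (hyz : y ≠ z) (s : List ℕ) (hp : p ∉ s) :
    (s.map (Trans.subst y z p)).prod =
      if FirstBefore y z s then Trans.y
      else if z ∈ s then (if y ∈ s then Trans.e else Trans.z) else 1 := by
  induction s with
  | nil => simp [FirstBefore]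
  | cons i s ih =>
    have hp' : p ∉ s := fun h => hp (List.mem_cons_of_mem _ h)
    have hpi : i ≠ p := fun h => hp (by simp [h])
    have hmem : FirstBefore y z s → y ∈ s := by
      rintro ⟨l, r, rfl, -⟩
      simp
    rw [List.map_cons, List.prod_cons, ih hp']
    by_cases hy : i = y
    · subst hy
      have h2 : Trans.subst i z p i = Trans.y := by simp [Trans.subst]
      rw [h2]
      simp only [firstBefore_cons, true_or, if_true]
      split_ifs <;> rfl
    · by_cases hz : i = z
      · subst hz
        have h2 : Trans.subst y i p i = Trans.z := by simp [Trans.subst, hyz.symm]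
        rw [h2]
        have hz : i ∉ s → y ∈ s → FirstBefore y i s := by
          intro h1 h2
          simpa using firstBefore_append (r := []) h2 h1
        simp only [firstBefore_cons, hy, ne_eq, not_true, false_and, or_self, if_false,
          List.mem_cons, true_or, if_true, hyz, false_or]
        split_ifs <;> first | rfl | tauto
      · have h2 : Trans.subst y z p i = 1 := by simp [Trans.subst, hy, hz, hpi]
        simp only [h2, one_mul, firstBefore_cons, List.mem_cons, Ne.symm hy, Ne.symm hz, hy,
          false_or, ne_eq, hz, not_false_eq_true, true_and]

theorem FirstBefore.of_satisfies {s t : List ℕ}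
    (h : Holds Trans s t) {y z : ℕ} (hyz : y ≠ z)
    (hs : FirstBefore y z s) : FirstBefore y z t := by
  classical
  obtain ⟨p, hp⟩ := Infinite.exists_notMem_finset (s ++ t).toFinset
  have hp : p ∉ s ∧ p ∉ t := by simpa using hp
  have := h (Trans.subst y z p)
  rw [prod_substTrans hyz _ hp.1, prod_substTrans hyz _ hp.2, if_pos hs] at this
  by_contra ht
  rw [if_neg ht] at this
  split_ifs at this

/-- The left side has value `py`, the map 0 ↦ 2: state 0 survives `s₁`, `p` sends it to 1, and `s₂`
sends 1 to 2. On the right, 1 is sent to 2 after `p` only if `y` comes before every `z` in `t₂`. -/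
theorem FirstBefore.of_satisfies_after_linear {s₁ s₂ t₁ t₂ : List ℕ} {p y z : ℕ}
    (h : Holds Trans (s₁ ++ p :: s₂) (t₁ ++ p :: t₂))
    (hs₁ : p ∉ s₁) (hs₂ : p ∉ s₂) (ht₁ : p ∉ t₁) (ht₂ : p ∉ t₂)
    (hyz : y ≠ z) (hy : y ≠ p) (hz : z ≠ p) (hys : y ∉ s₁)
    (hs : FirstBefore y z s₂) : FirstBefore y z t₂ := by
  classical
  by_contra ht
  have h2 : ¬ FirstBefore y z s₁ := by
    rintro ⟨l, r, rfl, -⟩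
    simp at hys
  have hc : Trans.subst y z p p = Trans.p := by simp [Trans.subst, hy.symm, hz.symm]
  have := h (Trans.subst y z p)
  simp only [List.map_append, List.map_cons, List.prod_append, List.prod_cons,
    prod_substTrans hyz _ hs₁, prod_substTrans hyz _ hs₂, prod_substTrans hyz _ ht₁,
    prod_substTrans hyz _ ht₂, if_pos hs, if_neg ht, if_neg h2, if_neg hys, hc] at this
  split_ifs at this <;> revert this <;> decide

end Trans

/-! ### Identities in few letters preserve a property of words -/

/-- All of the letters `1, …, n` occur in `w`; for `j < k` all occurrences of `j` precede all those
of `k`; and an occurrence of `0` preceded by `1` is also preceded by `n`. -/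
structure Unsplit (n : ℕ) (w : List ℕ) : Prop where
  mem : ∀ k, 1 ≤ k → k ≤ n → k ∈ w
  not_sublist : ∀ j k, 1 ≤ j → j < k → k ≤ n → ¬ [k, j].Sublist w
  last_mem : ∀ l r, w = l ++ 0 :: r → 1 ∈ l → n ∈ l

theorem pair_sublist_append {i j : ℕ} {l r : List ℕ} (hi : i ∈ l) (hj : j ∈ r) :
    [i, j].Sublist (l ++ r) :=
  (List.singleton_sublist.2 hi).append (List.singleton_sublist.2 hj)

theorem exists_split_of_pair_sublist {i j : ℕ} {l : List ℕ} (h : [i, j].Sublist l) :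
    ∃ l₁ l₂, l = l₁ ++ j :: l₂ ∧ i ∈ l₁ := by
  obtain ⟨l₁, l₂, rfl, h₁, h₂⟩ := List.append_sublist_iff.1 (show ([i] ++ [j]).Sublist l from h)
  obtain ⟨m₁, m₂, rfl⟩ := List.append_of_mem (List.singleton_sublist.1 h₂)
  exact ⟨l₁ ++ m₁, m₂, by simp, by simp [List.singleton_sublist.1 h₁]⟩

theorem exists_first_split {z : ℕ} {l : List ℕ} (h : z ∈ l) :
    ∃ l₁ l₂, l = l₁ ++ z :: l₂ ∧ z ∉ l₁ := by
  simpa using List.eq_append_cons_of_mem h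

theorem split_append {z : ℕ} {l r a b : List ℕ} (h : a ++ b = l ++ z :: r) :
    (∃ r', a = l ++ z :: r') ∨ ∃ l', l = a ++ l' ∧ b = l' ++ z :: r := by
  rcases List.append_eq_append_iff.1 h with ⟨c, hc, hd⟩ | ⟨c, hc, hd⟩
  · exact Or.inr ⟨c, hc, hd⟩
  · cases c with
    | nil => exact Or.inr ⟨[], by simpa using hc.symm, by simpa using hd.symm⟩
    | cons i c =>
      obtain ⟨rfl, -⟩ := List.cons.inj hd
      exact Or.inl ⟨c, hc⟩

theorem split_flatMap {x : ℕ} {f : ℕ → List ℕ} {t l r : List ℕ}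
    (h : t.flatMap f = l ++ x :: r) :
    ∃ t₁ z t₂ α β, t = t₁ ++ z :: t₂ ∧ f z = α ++ x :: β ∧ l = t₁.flatMap f ++ α := by
  induction t generalizing l with
  | nil => simp at h
  | cons i t ih =>
    rw [List.flatMap_cons] at h
    rcases split_append h with ⟨r', hr⟩ | ⟨l', rfl, hr⟩
    · exact ⟨[], i, t, l, r', rfl, hr, by simp⟩
    · obtain ⟨t₁, z, t₂, α, β, rfl, hz, rfl⟩ := ih hr
      exact ⟨i :: t₁, z, t₂, α, β, by simp, hz, by simp⟩

theorem notMem_of_linear {p : ℕ} {r l₁ l₂ : List ℕ} (hr : r = l₁ ++ p :: l₂)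
    (h : ¬ [p, p].Sublist r) : p ∉ l₁ ∧ p ∉ l₂ := by
  subst hr
  refine ⟨fun h' => h (pair_sublist_append h' (by simp)), fun h' => h ?_⟩
  exact List.Sublist.trans (by simpa using h') (List.sublist_append_right l₁ _)

/-- If `p` is a linear letter of an identity `s ≈ t`, and in `s` every occurrence of `z` preceded by
a letter of value containing `1` is preceded by one of value containing `n`, where letters of the
former kind do not occur after `p` and those of the latter kind do not occur before `p`, then the
same holds in `t`. -/
theorem mem_flatMap_of_linear {n p z : ℕ} {s t σ₁ σ₂ t₁ t₂ : List ℕ} {f : ℕ → List ℕ}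
    (hA : Holds (WithOne SemigroupA) s t) (hT : Holds Trans s t)
    (good : ∀ s₁ s₂, s = s₁ ++ z :: s₂ → 1 ∈ s₁.flatMap f → n ∈ s₁.flatMap f)
    (hs : s = σ₁ ++ p :: σ₂) (ht : t = t₁ ++ z :: t₂) (hp : ¬ [p, p].Sublist s) (hpz : p ≠ z)
    (hz : z ∈ σ₂) (h1after : 1 ∉ σ₂.flatMap f) (hnbefore : n ∉ σ₁.flatMap f)
    (h1 : 1 ∈ σ₁.flatMap f ∨ 1 ∈ f p) (h1t : 1 ∈ t₁.flatMap f) : n ∈ t₁.flatMap f := by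
  by_contra hnt
  have hpσ := notMem_of_linear hs hp
  have hpt : ¬ [p, p].Sublist t := (pair_sublist_iff_of_satisfies_A hA p p).not.1 hp
  have hptmem : p ∈ t := (mem_iff_of_satisfies_A hA p).1 (by simp [hs])
  rw [ht, List.mem_append, List.mem_cons] at hptmem
  rcases hptmem with hpt₁ | rfl | hpt₂
  -- If `p` precedes the given `z` in `t`, compare with the first `z` after `p` in `s`: some `y`
  -- with `n` in its value lies between them, and `Trans` carries this order over to `t`.
  · obtain ⟨τ₁, τ, rfl⟩ := List.append_of_mem hpt₁
    have htτ : t = τ₁ ++ p :: (τ ++ z :: t₂) := by simp [ht]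
    have hpτ := notMem_of_linear htτ hpt
    obtain ⟨ρ, ρ', rfl, hzρ⟩ := exists_first_split hz
    simp only [List.flatMap_append, List.flatMap_cons, List.mem_append, not_or] at hnt
    have hnρ : n ∈ ρ.flatMap f := by
      have := good (σ₁ ++ p :: ρ) ρ' (by simp [hs])
      simp only [List.flatMap_append, List.flatMap_cons, List.mem_append] at this
      tauto
    obtain ⟨y, hyρ, hny⟩ := List.mem_flatMap.1 hnρ
    have hyσ : y ∉ σ₁ := fun h => hnbefore (List.mem_flatMap.2 ⟨y, h, hny⟩)
    have hyz : y ≠ z := fun h => hzρ (h ▸ hyρ)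
    have hyp : y ≠ p := by
      rintro rfl
      exact hpσ.2 (by simp [hyρ])
    rw [hs, htτ] at hT
    have hF : FirstBefore y z (τ ++ z :: t₂) :=
      (firstBefore_append hyρ hzρ).of_satisfies_after_linear hT
        hpσ.1 hpσ.2 hpτ.1 hpτ.2 hyz hyp hpz.symm hyσ
    exact hnt.2.2 (List.mem_flatMap.2 ⟨y, hF.mem_of_eq hyz rfl, hny⟩)
  · exact hpz rfl
  -- If `p` follows the given `z` in `t`, A¹ moves the pair `y`, `z`, with 1 in the value of `y`, to
  -- before `p` in `s`. Then `good` puts `n` before `p`.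
  · obtain ⟨τ, τ₂, rfl⟩ := List.append_of_mem hpt₂
    have htτ : t = (t₁ ++ z :: τ) ++ p :: τ₂ := by simp [ht]
    have hpτ := notMem_of_linear htτ hpt
    obtain ⟨y, hyt, hy⟩ := List.mem_flatMap.1 h1t
    have hyσ : y ∉ σ₂ := fun h => h1after (List.mem_flatMap.2 ⟨y, h, hy⟩)
    rw [hs, htτ] at hA
    have hsub : [y, z].Sublist σ₁ := by
      refine pair_sublist_before_linear hA
        hpσ.1 hpσ.2 hpτ.1 hpτ.2 ?_ ?_ hpz.symm hyσ (pair_sublist_append hyt (by simp))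
      · rintro rfl
        exact hyσ hz
      · rintro rfl
        exact hpτ.1 (by simp [hyt])
    obtain ⟨l₁, l₂, rfl, hl⟩ := exists_split_of_pair_sublist hsub
    have := good l₁ (l₂ ++ p :: σ₂) (by simp [hs]) (List.mem_flatMap.2 ⟨y, hl, hy⟩)
    exact hnbefore (by simp only [List.flatMap_append, List.mem_append]; exact Or.inl this)

/-- Pigeonhole on a choice, for each of 1, …, n, of a letter whose value contains it. This is the
essential use of the bound on the number of letters. -/
theorem exists_lt_mem_of_card_lt {n : ℕ} {m : List ℕ} {A : Finset ℕ} {f : ℕ → List ℕ}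
    (hm : ∀ p ∈ m, p ∈ A) (hn : A.card < n) (hall : ∀ k, 1 ≤ k → k ≤ n → k ∈ m.flatMap f) :
    ∃ p ∈ m, ∃ j k, 1 ≤ j ∧ j < k ∧ k ≤ n ∧ j ∈ f p ∧ k ∈ f p := by
  have hall' : ∀ k : ℕ, ∃ p, 1 ≤ k → k ≤ n → p ∈ m ∧ k ∈ f p := by
    intro k
    by_cases h : 1 ≤ k ∧ k ≤ n
    · obtain ⟨p, hp⟩ := List.mem_flatMap.1 (hall k h.1 h.2)
      exact ⟨p, fun _ _ => hp⟩
    · exact ⟨0, fun h1 h2 => absurd ⟨h1, h2⟩ h⟩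
  choose g hg using hall'
  obtain ⟨j, hj, k, hk, hjk, hgjk⟩ := Finset.exists_ne_map_eq_of_card_lt_of_maps_to
    (s := Finset.Icc 1 n) (t := A) (f := g) (by simpa using hn) (by
      intro k hk
      have hk := Finset.mem_Icc.1 (Finset.mem_coe.1 hk)
      exact hm _ (hg k hk.1 hk.2).1)
  rw [Finset.mem_Icc] at hj hk
  have hgj := hg j hj.1 hj.2
  have hgk := hg k hk.1 hk.2
  rcases Nat.lt_or_gt_of_ne hjk with h | h
  · exact ⟨g j, hgj.1, j, k, hj.1, h, hk.2, hgj.2, hgjk ▸ hgk.2⟩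
  · exact ⟨g j, hgj.1, k, j, hk.1, h, hj.2, hgjk ▸ hgk.2, hgj.2⟩

set_option maxHeartbeats 600000 in
/-- The core combinatorial argument: an occurrence of `0` coming from the letter `z` of the right
side of an identity in fewer than `n` letters cannot split the sequence `1, …, n`. -/
theorem Unsplit.mem_of_split {n : ℕ} {s t : List ℕ} (hA : Holds (WithOne SemigroupA) s t)
    (hT : Holds Trans s t) (hn : s.toFinset.card < n) {f : ℕ → List ℕ} {w₁ w₂ : List ℕ}
    (hw : Unsplit n (w₁ ++ (s.flatMap f ++ w₂)))
    {t₁ t₂ α β : List ℕ} {z : ℕ} (ht : t = t₁ ++ z :: t₂) (hz : f z = α ++ 0 :: β)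
    (h1 : 1 ∈ w₁ ++ (t₁.flatMap f ++ α)) : n ∈ w₁ ++ (t₁.flatMap f ++ α) := by
  by_contra hcon
  simp only [List.mem_append, not_or] at hcon h1
  obtain ⟨hnw, hnt, hnα⟩ := hcon
  have hmem := mem_iff_of_satisfies_A hA
  have hpair := pair_sublist_iff_of_satisfies_A hA
  have good : ∀ s₁ s₂, s = s₁ ++ z :: s₂ → 1 ∈ w₁ ∨ 1 ∈ s₁.flatMap f ∨ 1 ∈ α →
      n ∈ s₁.flatMap f := by
    intro s₁ s₂ hs h
    have := hw.last_mem (w₁ ++ (s₁.flatMap f ++ α)) (β ++ (s₂.flatMap f ++ w₂))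
      (by simp [hs, hz]) (by simpa using h)
    simpa [hnw, hnα] using this
  have hzs : z ∈ s := (hmem z).2 (by simp [ht])
  obtain ⟨s₀, s₀', hs₀, hzs₀⟩ := exists_first_split hzs
  -- A letter occurring before the first `z` of `s` also occurs before the first `z` of `t`, hence
  -- in `t₁`.
  have hn₀ : n ∉ s₀.flatMap f := by
    intro h
    obtain ⟨y, hy, hny⟩ := List.mem_flatMap.1 h
    have hyz : y ≠ z := fun h => hzs₀ (h ▸ hy)
    have h3 : FirstBefore y z s := hs₀ ▸ firstBefore_append hy hzs₀
    exact hnt (List.mem_flatMap.2 ⟨y, (h3.of_satisfies hT hyz).mem_of_eq hyz ht, hny⟩)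
  have h1₀ : ¬ (1 ∈ w₁ ∨ 1 ∈ s₀.flatMap f ∨ 1 ∈ α) := fun h => hn₀ (good _ _ hs₀ h)
  simp only [not_or] at h1₀
  have h1t : 1 ∈ t₁.flatMap f := by tauto
  obtain ⟨y', hy't, hy'⟩ := List.mem_flatMap.1 h1t
  have hy'z : [y', z].Sublist s := by
    rw [hpair, ht]
    exact pair_sublist_append hy't (by simp)
  have hn1 : 1 < n := by
    rcases Nat.lt_or_ge 1 n with h | h
    · exact h
    · have : 0 < s.toFinset.card := Finset.card_pos.2 ⟨z, by simpa using hzs⟩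
      omega
  obtain ⟨s₁, s₂, hs₁, hy's₁⟩ := exists_split_of_pair_sublist hy'z
  have h1s₁ : 1 ∈ s₁.flatMap f := List.mem_flatMap.2 ⟨y', hy's₁, hy'⟩
  have hns₁ := good _ _ hs₁ (by tauto)
  -- the segment between the first `z` and the chosen one
  obtain ⟨m, hm⟩ : ∃ m, s₁ = s₀ ++ z :: m := by
    have h2 := hs₀.symm.trans hs₁
    rcases List.append_eq_append_iff.1 h2 with ⟨a, ha, hb⟩ | ⟨a, ha, hb⟩
    · cases a with
      | nil => exact absurd h1s₁ (by simpa [ha] using h1₀.2.1)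
      | cons i a =>
        obtain ⟨rfl, -⟩ := List.cons.inj hb
        exact ⟨a, ha⟩
    · rw [ha, List.flatMap_append] at h1₀
      exact absurd (List.mem_append_left _ h1s₁) h1₀.2.1
  subst hm
  have hs : s = s₀ ++ z :: (m ++ z :: s₂) := by simpa using hs₁
  have hwz : w₁ ++ (s.flatMap f ++ w₂) =
      (w₁ ++ (s₀.flatMap f ++ f z)) ++ (m.flatMap f ++ (f z ++ (s₂.flatMap f ++ w₂))) := by
    simp [hs]
  have sub : ∀ {j k : ℕ}, 1 ≤ j → j < k → k ≤ n → ∀ l r,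
      w₁ ++ (s.flatMap f ++ w₂) = l ++ r → k ∈ l → j ∉ r := by
    intro j k hj hjk hk l r h hkl hjr
    exact hw.not_sublist j k hj hjk hk (h ▸ pair_sublist_append hkl hjr)
  simp only [List.flatMap_append, List.flatMap_cons, List.mem_append] at hns₁ h1s₁
  have h1z : 1 ∉ f z := by
    intro h
    refine sub le_rfl hn1 le_rfl (w₁ ++ ((s₀ ++ z :: m).flatMap f))
      (f z ++ (s₂.flatMap f ++ w₂)) (by simp [hs]) ?_ (by simp [h])
    simp only [List.flatMap_append, List.flatMap_cons, List.mem_append]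
    tauto
  have h1m : 1 ∈ m.flatMap f := by tauto
  have hnm : n ∈ m.flatMap f := by
    rcases hns₁ with h | h | h
    · exact absurd h hn₀
    · refine absurd ?_ (sub le_rfl hn1 le_rfl _ _ hwz (by simp [h]))
      simp only [List.mem_append]
      tauto
    · exact h
  -- As 1 and `n` both come from `m`, the prescribed order forces all the numbers between them into
  -- `m`.
  have hall : ∀ k, 1 ≤ k → k ≤ n → k ∈ m.flatMap f := by
    intro k hk hkn
    rcases hk.eq_or_lt with rfl | hk1
    · exact h1m
    rcases hkn.eq_or_lt with rfl | hkn1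
    · exact hnm
    have hkw := hw.mem k hk hkn
    rw [hwz, List.mem_append, List.mem_append (s := m.flatMap f)] at hkw
    rcases hkw with h | h | h
    · exact absurd (List.mem_append_left _ h1m) (sub le_rfl hk1 hkn _ _ hwz h)
    · exact h
    · exact absurd h (sub hk hkn1 le_rfl ((w₁ ++ (s₀.flatMap f ++ f z)) ++ m.flatMap f) _
        (by simp [hs]) (List.mem_append_right _ hnm))
  -- a linear letter between two occurrences of `z`
  obtain ⟨p, hpm, j, k, hj, hjk, hkn, hjp, hkp⟩ := exists_lt_mem_of_card_lt
    (m := m) (A := s.toFinset) (fun p hp => by simp [hs, hp]) hn hall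
  -- Two occurrences of `p` would put `k` from the first before `j` from the second.
  have hpp : ¬ [p, p].Sublist s := by
    intro h
    obtain ⟨l₁, l₂, rfl, h₁, h₂⟩ := List.append_sublist_iff.1 (show ([p] ++ [p]).Sublist s from h)
    refine sub hj hjk hkn (w₁ ++ l₁.flatMap f) (l₂.flatMap f ++ w₂) (by simp) ?_ ?_
    · exact List.mem_append_right _ (List.mem_flatMap.2 ⟨p, List.singleton_sublist.1 h₁, hkp⟩)
    · exact List.mem_append_left _ (List.mem_flatMap.2 ⟨p, List.singleton_sublist.1 h₂, hjp⟩)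
  have hpz : p ≠ z := by
    rintro rfl
    apply hpp
    rw [hs]
    exact List.Sublist.trans (by simp) (List.sublist_append_right s₀ _)
  obtain ⟨m₁, m₂, rfl⟩ := List.append_of_mem hpm
  have hsσ : s = (s₀ ++ z :: m₁) ++ p :: (m₂ ++ z :: s₂) := by simp [hs]
  have h1after : 1 ∉ (m₂ ++ z :: s₂).flatMap f := fun h =>
    sub le_rfl (hj.trans_lt hjk) hkn (w₁ ++ ((s₀ ++ z :: m₁).flatMap f ++ f p))
      ((m₂ ++ z :: s₂).flatMap f ++ w₂) (by simp [hsσ]) (List.mem_append_right _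
        (List.mem_append_right _ hkp)) (List.mem_append_left _ h)
  have hnbefore : n ∉ (s₀ ++ z :: m₁).flatMap f := fun h =>
    sub hj (hjk.trans_le hkn) le_rfl (w₁ ++ (s₀ ++ z :: m₁).flatMap f)
      (f p ++ ((m₂ ++ z :: s₂).flatMap f ++ w₂)) (by simp [hsσ]) (List.mem_append_right _ h)
      (List.mem_append_left _ hjp)
  refine hnt (mem_flatMap_of_linear hA hT (fun s₁ s₂ h h' => good s₁ s₂ h (Or.inr (Or.inl h')))
    hsσ ht hpp hpz (by simp) h1after hnbefore ?_ h1t)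
  simp only [List.flatMap_append, List.flatMap_cons, List.mem_append] at h1m h1after ⊢
  tauto

/-- The first two conditions depend only on the content and the two-letter scattered subwords, both
fixed by A¹. For the third, only a 0 inside the substituted part is delicate; one in `w₁` or `w₂`
sees the same set of preceding letters on both sides. -/
theorem Unsplit.of_holds {n : ℕ} {s t : List ℕ} (hA : Holds (WithOne SemigroupA) s t)
    (hT : Holds Trans s t) (hn : s.toFinset.card < n) {f : ℕ → List ℕ} {w₁ w₂ : List ℕ}
    (hw : Unsplit n (w₁ ++ (s.flatMap f ++ w₂))) : Unsplit n (w₁ ++ (t.flatMap f ++ w₂)) := by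
  have hA' := hA.context f w₁ w₂
  refine ⟨fun k h1 h2 => (mem_iff_of_satisfies_A hA' k).1 (hw.mem k h1 h2),
    fun j k h1 h2 h3 => (pair_sublist_iff_of_satisfies_A hA' k j).not.1
      (hw.not_sublist j k h1 h2 h3), ?_⟩
  intro l r hlr h1
  rcases split_append hlr with ⟨r', rfl⟩ | ⟨l', rfl, hb⟩
  · exact hw.last_mem l (r' ++ (s.flatMap f ++ w₂)) (by simp) h1
  · rcases split_append hb with ⟨r', hr⟩ | ⟨l', rfl, rfl⟩
    · obtain ⟨t₁, z, t₂, α, β, ht, hz, rfl⟩ := split_flatMap hr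
      exact hw.mem_of_split hA hT hn ht hz h1
    · have hst : ∀ k, k ∈ t.flatMap f ↔ k ∈ s.flatMap f := by
        intro k
        simp only [List.mem_flatMap, mem_iff_of_satisfies_A hA]
      have := hw.last_mem (w₁ ++ (s.flatMap f ++ l')) r (by simp)
      simp only [List.mem_append, hst] at this h1 ⊢
      exact this h1

/-! ### The separating identities -/

/-- The word `2² 3² ⋯ n²`. -/
def squares (n : ℕ) : List ℕ := (List.range (n - 1)).flatMap fun i => [i + 2, i + 2]

/-- The word `0 1² 2² ⋯ n² 0`. -/
def unsplitWord (n : ℕ) : List ℕ := 0 :: 1 :: 1 :: (squares n ++ [0])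

/-- The word `0 1² 0 2² ⋯ n² 0`. -/
def splitWord (n : ℕ) : List ℕ := 0 :: 1 :: 1 :: 0 :: (squares n ++ [0])

theorem mem_squares {n k : ℕ} : k ∈ squares n ↔ 2 ≤ k ∧ k ≤ n := by
  simp only [squares, List.mem_flatMap, List.mem_range, List.mem_cons, List.not_mem_nil, or_false,
    or_self]
  constructor
  · rintro ⟨i, hi, rfl⟩
    omega
  · rintro ⟨h1, h2⟩
    exact ⟨k - 2, by omega, by omega⟩

theorem pairwise_squares (n : ℕ) : (squares n).Pairwise (· ≤ ·) := by
  rw [squares, List.pairwise_flatMap]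
  refine ⟨fun i _ => by simp, List.pairwise_lt_range.imp ?_⟩
  intro i j hij x hx y hy
  simp only [List.mem_cons, List.not_mem_nil, or_false, or_self] at hx hy
  omega

theorem unsplit_unsplitWord {n : ℕ} (hn : 2 ≤ n) : Unsplit n (unsplitWord n) := by
  refine ⟨?_, ?_, ?_⟩
  · intro k h1 h2
    rcases h1.eq_or_lt with rfl | h1
    · simp [unsplitWord]
    · have : k ∈ squares n := mem_squares.2 ⟨h1, h2⟩
      simp [unsplitWord, this]
  · intro j k hj hjk hk h
    -- Deleting every 0 leaves a nondecreasing word and keeps the pair `k`, `j`, as both are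
    -- positive.
    have h0 : (squares n).filter (· ≠ 0) = squares n := by
      rw [List.filter_eq_self]
      intro a ha
      have := (mem_squares.1 ha).1
      simp only [decide_eq_true_eq]
      omega
    have hf := h.filter (· ≠ 0)
    have hl : [k, j].filter (· ≠ 0) = [k, j] := by
      rw [List.filter_eq_self]
      intro a ha
      simp only [List.mem_cons, List.not_mem_nil, or_false] at ha
      simp only [decide_eq_true_eq]
      omega
    have hu : (unsplitWord n).filter (· ≠ 0) = 1 :: 1 :: squares n := by
      have : unsplitWord n = [0] ++ ([1, 1] ++ (squares n ++ [0])) := rfl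
      rw [this, List.filter_append, List.filter_append, List.filter_append, h0]
      simp
    rw [hl, hu] at hf
    have hp : (1 :: 1 :: squares n).Pairwise (· ≤ ·) := by
      have h2 : ∀ a ∈ squares n, 1 ≤ a := fun a ha => by
        have := (mem_squares.1 ha).1
        omega
      refine List.Pairwise.cons ?_ (List.Pairwise.cons h2 (pairwise_squares n))
      intro a ha
      rcases List.mem_cons.1 ha with rfl | ha
      · exact le_rfl
      · exact h2 a ha
    have := List.pairwise_pair.1 (hp.sublist hf)
    omega
  · intro l r h h1
    have hw : (0 :: 1 :: 1 :: squares n) ++ [0] = l ++ 0 :: r := h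
    rcases split_append hw with ⟨r', hr⟩ | ⟨l', rfl, -⟩
    · cases l with
      | nil => simp at h1
      | cons i l =>
        have h0 : 0 ∈ 1 :: 1 :: squares n := by
          rw [(List.cons.inj hr).2]
          simp
        simp [mem_squares] at h0
    · have : n ∈ squares n := mem_squares.2 ⟨hn, le_rfl⟩
      simp [this]

theorem not_unsplit_splitWord {n : ℕ} (hn : 2 ≤ n) : ¬ Unsplit n (splitWord n) := by
  intro h
  have := h.last_mem [0, 1, 1] (squares n ++ [0]) rfl (by simp)
  simp only [List.mem_cons, List.not_mem_nil, or_false] at this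
  omega

theorem holds_E (n : ℕ) : Holds (WithOne SemigroupE) (unsplitWord n) (splitWord n) := by
  intro f
  have key : ∀ x y q : WithOne SemigroupE,
      x * (y * (y * (q * x))) = x * (y * (y * (x * (q * x)))) := by decide
  simpa [unsplitWord, splitWord] using key _ _ _

/-- The values in `A¹` of words not involving a letter of value `c` or `bc`. -/
theorem prod_ne_of_forall_ne {f : ℕ → WithOne SemigroupA} {s : List ℕ}
    (h : ∀ i ∈ s, f i ≠ (SemigroupA.c : SemigroupA) ∧ f i ≠ (SemigroupA.bc : SemigroupA)) :
    (s.map f).prod ≠ (SemigroupA.c : SemigroupA) ∧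
      (s.map f).prod ≠ (SemigroupA.bc : SemigroupA) := by
  induction s with
  | nil => simp
  | cons i s ih =>
    rw [List.map_cons, List.prod_cons]
    have key : ∀ u v : WithOne SemigroupA,
        (u ≠ (SemigroupA.c : SemigroupA) ∧ u ≠ (SemigroupA.bc : SemigroupA)) →
        (v ≠ (SemigroupA.c : SemigroupA) ∧ v ≠ (SemigroupA.bc : SemigroupA)) →
        (u * v ≠ (SemigroupA.c : SemigroupA) ∧ u * v ≠ (SemigroupA.bc : SemigroupA)) := by
      decide
    exact key _ _ (h i (by simp)) (ih fun j hj => h j (List.mem_cons_of_mem _ hj))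

theorem prod_squares_ne (f : ℕ → WithOne SemigroupA) (n : ℕ) :
    ((squares n).map f).prod ≠ (SemigroupA.c : SemigroupA) ∧
      ((squares n).map f).prod ≠ (SemigroupA.bc : SemigroupA) := by
  have key : ∀ u : WithOne SemigroupA,
      u * u ≠ (SemigroupA.c : SemigroupA) ∧ u * u ≠ (SemigroupA.bc : SemigroupA) := by decide
  have := prod_ne_of_forall_ne (f := fun i => f i * f i) (s := (List.range (n - 1)).map (· + 2))
    (fun i _ => key _)
  rw [squares, prod_flatMap]
  simpa [Function.comp_def] using this

/-- The restriction on `q` is needed: x = b, y = a, q = c gives bc on the left and 0 on the right.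
Products of squares avoid c and bc. -/
theorem holds_A (n : ℕ) : Holds (WithOne SemigroupA) (unsplitWord n) (splitWord n) := by
  intro f
  have key : ∀ x y q : WithOne SemigroupA,
      (q ≠ (SemigroupA.c : SemigroupA) ∧ q ≠ (SemigroupA.bc : SemigroupA)) →
      x * (y * (y * (q * x))) = x * (y * (y * (x * (q * x)))) := by decide
  simpa [unsplitWord, splitWord] using key _ (f 1) _ (prod_squares_ne f n)

/-! ### Syntactic monoids -/

/-- The syntactic congruence of a set of words. -/
def syntacticCon (Q : List ℕ → Prop) : Con Word where
  r u v := ∀ l r : List ℕ, Q (l ++ (u.toList ++ r)) ↔ Q (l ++ (v.toList ++ r))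
  iseqv := ⟨fun _ _ _ => Iff.rfl, fun h l r => (h l r).symm,
    fun h h' l r => (h l r).trans (h' l r)⟩
  mul' {u v u' v'} h h' l r := by
    have h1 := h l (u'.toList ++ r)
    have h2 := h' (l ++ v.toList) r
    simp only [FreeMonoid.toList_mul, List.append_assoc] at h1 h2 ⊢
    exact h1.trans h2

/-- A substitution into the quotient lifts to a substitution of words, so closure of `Q` under
replacing `s` by `t` in context suffices. -/
theorem satisfies_syntacticCon {Q : List ℕ → Prop} {s t : List ℕ}
    (h : ∀ (f : ℕ → List ℕ) (l r : List ℕ),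
      Q (l ++ (s.flatMap f ++ r)) ↔ Q (l ++ (t.flatMap f ++ r))) :
    Holds (syntacticCon Q).Quotient s t := by
  intro g
  choose f hf using fun i => Con.mk'_surjective (c := syntacticCon Q) (g i)
  have hg : ∀ w : List ℕ, (w.map g).prod =
      (syntacticCon Q).mk' (FreeMonoid.ofList (w.flatMap fun i => (f i).toList)) := by
    intro w
    induction w with
    | nil => rfl
    | cons i w ih =>
      rw [List.map_cons, List.prod_cons, ih, List.flatMap_cons, FreeMonoid.ofList_append, map_mul,
        FreeMonoid.ofList_toList, hf]
  rw [hg, hg]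
  exact (Con.eq _).2 fun l r => h (fun i => (f i).toList) l r

theorem not_holds_syntacticCon {Q : List ℕ → Prop} {s t : List ℕ} (hs : Q s) (ht : ¬ Q t) :
    ¬ Holds (syntacticCon Q).Quotient s t := by
  intro h
  have hg : ∀ w : List ℕ, (w.map fun i => (syntacticCon Q).mk' (FreeMonoid.of i)).prod =
      (syntacticCon Q).mk' (FreeMonoid.ofList w) := by
    intro w
    induction w with
    | nil => rfl
    | cons i w ih => rw [List.map_cons, List.prod_cons, ih, FreeMonoid.ofList_cons, map_mul]
  have := h fun i => (syntacticCon Q).mk' (FreeMonoid.of i)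
  rw [hg, hg] at this
  have := (Con.eq _).1 this [] []
  simp only [FreeMonoid.toList_ofList, List.nil_append, List.append_nil] at this
  exact ht (this.1 hs)

/-! ### Varieties -/

theorem generatedByMonoid_mem (S : Type) [Monoid S] :
    (MonoidVariety.generatedByMonoid.{u} S).Mem (ULift.{u} S) :=
  fun _ hW => hW _ ⟨MulEquiv.ulift⟩

theorem generatedByMonoid_le {S : Type} [Monoid S] {e : Identity} (h : Satisfies S e) :
    MonoidVariety.generatedByMonoid.{u} S ≤ MonoidVariety.ofIdentities {e} := by
  intro M _ hM
  refine hM _ ?_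
  rintro N _ ⟨i⟩ _ rfl φ
  exact i.injective (h (i.toMonoidHom.comp φ))

end MonVar

theorem corollary3p3 (V : MonVar.MonoidVariety.{u})
    (hlower : MonVar.varA1 ⊔ MonVar.varE1Sigma 2 ≤ V)
    (hupper : V ≤ MonVar.varA1 ⊔ MonVar.varE1) :
    ¬ V.IsFinitelyBased := by
  rintro ⟨E, hE, rfl⟩
  have hA : ∀ e ∈ E, MonVar.Holds (WithOne MonVar.SemigroupA) e.1.toList e.2.toList := by
    intro e he
    rw [← MonVar.satisfies_iff_holds, ← MonVar.satisfies_uLift.{u}]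
    exact (le_sup_left.trans hlower) _ (MonVar.generatedByMonoid_mem _) e he
  have hT : ∀ e ∈ E, MonVar.Holds MonVar.Trans e.1.toList e.2.toList := by
    intro e he
    rw [← MonVar.satisfies_iff_holds, ← MonVar.satisfies_uLift.{u}]
    exact (le_sup_right.trans hlower) _ MonVar.Trans.mem_varE1Sigma e he
  obtain ⟨n, hn, hEn⟩ : ∃ n, 2 ≤ n ∧ ∀ e ∈ E,
      e.1.toList.toFinset.card < n ∧ e.2.toList.toFinset.card < n := by
    refine ⟨(∑ e ∈ hE.toFinset, (e.1.toList.toFinset.card + e.2.toList.toFinset.card)) + 2,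
      by omega, fun e he => ?_⟩
    have := Finset.single_le_sum
      (f := fun e : MonVar.Identity => e.1.toList.toFinset.card + e.2.toList.toFinset.card)
      (fun _ _ => Nat.zero_le _) (hE.mem_toFinset.2 he)
    omega
  have hM : (MonVar.MonoidVariety.ofIdentities.{u} E).Mem
      (ULift.{u} (MonVar.syntacticCon (MonVar.Unsplit n)).Quotient) := by
    intro e he
    rw [MonVar.satisfies_uLift]
    -- Each identity is applied in both directions, which is why `n` has to bound the letters of
    -- both sides.
    exact MonVar.satisfies_iff_holds.2 (MonVar.satisfies_syntacticCon fun f l r =>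
      ⟨fun h => h.of_holds (hA e he) (hT e he) (hEn e he).1,
        fun h => h.of_holds (hA e he).symm (hT e he).symm (hEn e he).2⟩)
  have hle : MonVar.MonoidVariety.ofIdentities.{u} E ≤ MonVar.MonoidVariety.ofIdentities
      {(FreeMonoid.ofList (MonVar.unsplitWord n), FreeMonoid.ofList (MonVar.splitWord n))} :=
    hupper.trans (sup_le
      (MonVar.generatedByMonoid_le (MonVar.satisfies_iff_holds.2 (MonVar.holds_A n)))
      (MonVar.generatedByMonoid_le (MonVar.satisfies_iff_holds.2 (MonVar.holds_E n))))
  have := hle _ hM _ rfl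
  rw [MonVar.satisfies_uLift, MonVar.satisfies_iff_holds] at this
  exact MonVar.not_holds_syntacticCon (MonVar.unsplit_unsplitWord hn)
    (MonVar.not_unsplit_splitWord hn) this
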